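/- All graphs are finite, simple and undirected. For a connected graph $G$ with at least one edge, let $\kappa(G)=\sum_{i}\sum_{j\ne i}\pi_i m_{ij}\pi_j$ be Kemeny's constant of the simple random walk on $G$, where $\pi_v=\deg_G(v)/(2|E(G)|)$ is the stationary distribution and $m_{ij}$ is the mean first passage time from $i$ to $j$. A vertex $v$ of a tree on $n$ vertices is a centroid if every connected component of the tree with $v$ deleted has at most $\lfloor n/2\rfloor$ vertices. Let $\mathcal T$ be a tree with vertex set $\{1,\dots,k\}$, $k\ge 2$, and let $G_1,\dots,G_k$ be trees. A chain of $G_1,\dots,G_k$ with respect to $\mathcal T$ is a graph obtained from the disjoint union of $G_1,\dots,G_k$ by adding, for each edge $i\sim j$ of $\mathcal T$, one edge (a bridge) $v_i\sim v_j$ joining some chosen vertex $v_i\in V(G_i)$ to some chosen vertex $v_j\in V(G_j)$. For a chain $G$, let $\mathcal B_G$ be the set of these $k-1$ bridges and let $\widetilde V_i^G$ be the set of vertices of $G_i$ incident with a bridge in $\mathcal B_G$. Then a chain $G$ of $G_1,\dots,G_k$ with respect to $\mathcal T$ attains the minimum of $\kappa$ over all chains of $G_1,\dots,G_k$ with respect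 to $\mathcal T$ if and only if both of the following hold: for each bridge $x\sim y\in\mathcal B_G$, the vertices $x$ and $y$ are centroids of the trees among $G_1,\dots,G_k$ that contain them; and for each $i\in\{1,\dots,k\}$ the set $\widetilde V_i^G$ is a singleton. -/

import Mathlib

open scoped ENNReal

namespace KemenyChain

universe u v

section MarkovChain

variable {S : Type u} [Fintype S]

open Classical in
/-- The probability that the Markov chain with transition matrix `P`, started at `i`, visits `j`
for the first time after time `0` exactly at time `t`: the sum, over all trajectories
`i = x 0, x 1, …, x t = j` with `x s ≠ j` for `0 < s < t`, of the probability
`∏ P (x s) (x (s+1))` of the trajectory. Only used for `t ≥ 1`. -/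
noncomputable def firstPassageProb (P : Matrix S S ℝ≥0∞) (i j : S) (t : ℕ) : ℝ≥0∞ :=
  ∑ x : Fin (t + 1) → S with
      x 0 = i ∧ x (Fin.last t) = j ∧ ∀ s, s ≠ 0 → s ≠ Fin.last t → x s ≠ j,
    ∏ s : Fin t, P (x s.castSucc) (x s.succ)

/-- The mean first passage time from `i` to `j`: the expectation of the first time `t ≥ 1` at which
the chain started at `i` is at `j`. The second summand is the contribution `∞ · Prob(never)`. -/
noncomputable def meanFirstPassageTime (P : Matrix S S ℝ≥0∞) (i j : S) : ℝ≥0∞ :=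
  ∑' t : ℕ, ((t + 1 : ℕ) : ℝ≥0∞) * firstPassageProb P i j (t + 1)
    + ⊤ * (1 - ∑' t : ℕ, firstPassageProb P i j (t + 1))

open Classical in
/-- Kemeny's constant of the chain with transition matrix `P` and stationary vector `π`. -/
noncomputable def kemenyOf (P : Matrix S S ℝ≥0∞) (π : S → ℝ≥0∞) : ℝ≥0∞ :=
  ∑ i, ∑ j with j ≠ i, π i * meanFirstPassageTime P i j * π j

end MarkovChain

section Graph

variable {W : Type u} [Fintype W]

open Classical in
/-- Transition matrix of the simple random walk on `G`. -/
noncomputable def walkMatrix (G : SimpleGraph W) : Matrix W W ℝ≥0∞ :=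
  fun v w => if G.Adj v w then (G.degree v : ℝ≥0∞)⁻¹ else 0

open Classical in
/-- The stationary distribution `deg v / (2 |E(G)|)` of the simple random walk on `G`. -/
noncomputable def walkStationary (G : SimpleGraph W) : W → ℝ≥0∞ :=
  fun v => (G.degree v : ℝ≥0∞) / (2 * (G.edgeFinset.card : ℝ≥0∞))

/-- Kemeny's constant `κ(G)` of the simple random walk on `G`. -/
noncomputable def kemeny (G : SimpleGraph W) : ℝ≥0∞ :=
  kemenyOf (walkMatrix G) (walkStationary G)

/-- `walkStationary G` is invariant under the walk. -/
theorem walkStationary_invariant (G : SimpleGraph W) (w : W) :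
    ∑ v, walkStationary G v * walkMatrix G v w = walkStationary G w := by
  classical
  have key : ∀ v, walkStationary G v * walkMatrix G v w
      = if G.Adj w v then (2 * (G.edgeFinset.card : ℝ≥0∞))⁻¹ else 0 := by
    intro v
    by_cases h : G.Adj v w
    · have hd : G.degree v ≠ 0 := fun h0 => by
        have := (G.degree_pos_iff_exists_adj v).2 ⟨w, h⟩
        omega
      have hd' : (G.degree v : ℝ≥0∞) ≠ 0 := by exact_mod_cast hd
      unfold walkStationary walkMatrix
      rw [if_pos h, if_pos h.symm, div_eq_mul_inv, mul_right_comm]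
      convert one_mul _
      convert ENNReal.mul_inv_cancel hd' (ENNReal.natCast_ne_top _)
    · have h' : ¬ G.Adj w v := fun h2 => h h2.symm
      simp [walkMatrix, h, h']
  simp only [key]
  rw [← Finset.sum_filter, Finset.sum_const, nsmul_eq_mul]
  unfold walkStationary
  rw [div_eq_mul_inv]
  congr 3
  ext x
  simp

/-- `walkStationary G` is a probability vector as soon as `G` has an edge. -/
theorem walkStationary_sum (G : SimpleGraph W) (h : G.edgeSet.Nonempty) :
    ∑ v, walkStationary G v = 1 := by
  classical
  unfold walkStationary
  simp only [div_eq_mul_inv]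
  rw [← Finset.sum_mul, ← Nat.cast_sum, G.sum_degrees_eq_twice_card_edges]
  push_cast
  have hc : G.edgeFinset.card ≠ 0 := by
    rw [Finset.card_ne_zero]
    obtain ⟨e, he⟩ := h
    exact ⟨e, by simpa using he⟩
  convert ENNReal.mul_inv_cancel (a := 2 * (G.edgeFinset.card : ℝ≥0∞))
    (by simpa using hc) (by finiteness)

/-- `v` is a centroid of `G`: every connected component of `G - v` has at most `⌊n / 2⌋` vertices,
where `n` is the number of vertices of `G`. -/
def IsCentroid (G : SimpleGraph W) (v : W) : Prop :=
  ∀ c : (G.induce ({v}ᶜ : Set W)).ConnectedComponent, c.supp.ncard ≤ Fintype.card W / 2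

end Graph

/-- A chain of the graphs `G i` with respect to `T`, given by the choice, for every edge
`i ∼ j` of `T`, of an end `vertex i j` in block `i` (and of an end `vertex j i` in block `j`). -/
structure TreeChain {ι : Type u} (T : SimpleGraph ι) {V : ι → Type v}
    (G : ∀ i, SimpleGraph (V i)) where
  vertex : ∀ i j, T.Adj i j → V i

namespace TreeChain

variable {ι : Type u} {T : SimpleGraph ι} {V : ι → Type v} {G : ∀ i, SimpleGraph (V i)}

/-- The bridges of the chain, one for each edge `i ∼ j` of `T`. -/
def bridges (C : TreeChain T G) : Set (Sym2 (Σ i, V i)) :=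
  {e | ∃ i j, ∃ h : T.Adj i j, e = s(⟨i, C.vertex i j h⟩, ⟨j, C.vertex j i h.symm⟩)}

/-- The graph of the chain, on the disjoint union of the blocks: its edges are the edges of the
blocks and the bridges. -/
def graph (C : TreeChain T G) : SimpleGraph (Σ i, V i) where
  Adj x y := (∃ i, ∃ a b : V i, (G i).Adj a b ∧ x = ⟨i, a⟩ ∧ y = ⟨i, b⟩) ∨ s(x, y) ∈ C.bridges
  symm := ⟨by
    rintro x y (⟨i, a, b, h, rfl, rfl⟩ | h)
    · exact Or.inl ⟨i, b, a, h.symm, rfl, rfl⟩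
    · exact Or.inr (by rwa [Sym2.eq_swap])⟩
  loopless := ⟨by
    rintro x (⟨i, a, b, h, rfl, hb⟩ | ⟨i, j, h, he⟩)
    · simp only [Sigma.mk.injEq, heq_eq_eq, true_and] at hb
      exact h.ne hb
    · rw [Sym2.eq_iff] at he
      have : i = j := by
        rcases he with ⟨h1, h2⟩ | ⟨h1, h2⟩
        · exact congrArg Sigma.fst (h1.symm.trans h2)
        · exact congrArg Sigma.fst (h2.symm.trans h1)
      exact h.ne this⟩

/-- The set of vertices of block `i` that are incident with a bridge. -/
def bridgeVertices (C : TreeChain T G) (i : ι) : Set (V i) :=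
  {a | ∃ e ∈ C.bridges, (⟨i, a⟩ : Σ i, V i) ∈ e}

end TreeChain

end KemenyChain

namespace KemenyChain

universe u v

/-! ### Mean first passage times from the first-step equations -/

section FirstPassage

variable {S : Type u} [Fintype S]

/-! On a tree the hitting time is an explicit degree-weighted sum of distances
(`degree_mul_hittingTime`). Summing it against the stationary distribution makes Kemeny's constant
an increasing affine function of the Wiener index, with coefficients depending only on the number of
vertices (`exists_kemeny_eq`). All chains share one vertex set, so the question is which of them
minimise the Wiener index.

The distance in a chain is the distance of the blocks in `T` plus, for each block `l`, the distance
in `l` between the projections of the two points (`isTreeMetric_chainDist`). The first part is the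
same for every chain. In the share of block `l`, pairs inside `l` contribute a constant; mixed pairs
contribute distance sums from attachment vertices, which are least exactly at centroids
(`isCentroid_iff`); pairs outside `l` contribute distances between attachment vertices, which all
vanish iff these vertices coincide. Attaching every bridge at one centroid per block meets all lower
bounds at once, so a minimiser must meet each of them. -/

theorem firstPassageProb_one (P : Matrix S S ℝ≥0∞) (i j : S) :
    firstPassageProb P i j 1 = P i j := by
  classical
  unfold firstPassageProb
  rw [Finset.sum_eq_single ![i, j]]
  · simp
  · intro x hx hne
    exfalso
    apply hne
    simp only [Finset.mem_filter, Finset.mem_univ, true_and] at hx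
    funext s
    fin_cases s
    · exact hx.1
    · exact hx.2.1
  · intro h
    exfalso
    apply h
    simp only [Finset.mem_filter, Finset.mem_univ, true_and]
    refine ⟨rfl, rfl, ?_⟩
    intro s h0 h1
    fin_cases s
    · exact absurd rfl h0
    · exact absurd rfl h1

open Classical in
-- Split off the first step of the trajectory. With at least two steps, time `1` is an intermediate
-- time, hence the restriction `k ≠ j`.
theorem firstPassageProb_succ_succ (P : Matrix S S ℝ≥0∞) (i j : S) (t : ℕ) :
    firstPassageProb P i j (t + 2)
      = ∑ k with k ≠ j, P i k * firstPassageProb P k j (t + 1) := by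
  unfold firstPassageProb
  simp only [Finset.mul_sum, Finset.sum_filter, mul_ite, mul_zero]
  rw [← (Fin.consEquiv (fun _ : Fin (t + 3) => S)).sum_comp, Fintype.sum_prod_type,
    Finset.sum_eq_single i]
  rotate_left
  · intro a _ ha
    refine Finset.sum_eq_zero fun y _ => if_neg ?_
    rintro ⟨h, -⟩
    exact ha (by simpa [Fin.consEquiv] using h)
  · simp
  have hcond : ∀ y : Fin (t + 2) → S,
      (((Fin.consEquiv fun _ : Fin (t + 3) => S) (i, y)) 0 = i ∧
        ((Fin.consEquiv fun _ : Fin (t + 3) => S) (i, y)) (Fin.last (t + 2)) = j ∧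
        ∀ s, s ≠ 0 → s ≠ Fin.last (t + 2) →
          ((Fin.consEquiv fun _ : Fin (t + 3) => S) (i, y)) s ≠ j) ↔
      (y 0 ≠ j ∧ y (Fin.last (t + 1)) = j ∧ ∀ s, s ≠ 0 → s ≠ Fin.last (t + 1) → y s ≠ j) := by
    intro y
    simp only [Fin.consEquiv, Equiv.coe_fn_mk, Fin.cons_zero, true_and, ← Fin.succ_last,
      Fin.cons_succ]
    constructor
    · rintro ⟨h1, h2⟩
      have h3 : ∀ s : Fin (t + 2), s ≠ Fin.last (t + 1) → y s ≠ j := by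
        intro s hs
        have := h2 s.succ (Fin.succ_ne_zero s) (fun h => hs (Fin.succ_injective _ h))
        simpa using this
      exact ⟨h3 0 (Fin.last_pos.ne), h1, fun s _ hs => h3 s hs⟩
    · rintro ⟨h0, h1, h2⟩
      refine ⟨h1, fun s hs0 hs => ?_⟩
      obtain ⟨s, rfl⟩ := Fin.exists_succ_eq.2 hs0
      rw [Fin.cons_succ]
      by_cases h : s = 0
      · rw [h]; exact h0
      · exact h2 s h fun h' => hs (by rw [h'])
  have hrhs : ∀ k : S, (if k ≠ j then ∑ y : Fin (t + 2) → S,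
        (if y 0 = k ∧ y (Fin.last (t + 1)) = j ∧ ∀ s, s ≠ 0 → s ≠ Fin.last (t + 1) → y s ≠ j
          then P i k * ∏ s : Fin (t + 1), P (y s.castSucc) (y s.succ) else 0) else 0)
      = ∑ y : Fin (t + 2) → S, if y 0 = k then
        (if y 0 ≠ j ∧ y (Fin.last (t + 1)) = j ∧ ∀ s, s ≠ 0 → s ≠ Fin.last (t + 1) → y s ≠ j
          then P i (y 0) * ∏ s : Fin (t + 1), P (y s.castSucc) (y s.succ) else 0) else 0 := by
    intro k
    by_cases hk : k = j
    · rw [if_neg (by simpa using hk)]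
      symm
      refine Finset.sum_eq_zero fun y _ => ?_
      by_cases h : y 0 = k
      · rw [if_pos h, if_neg]
        rintro ⟨h', -⟩
        exact h' (h.trans hk)
      · rw [if_neg h]
    · rw [if_pos hk]
      refine Finset.sum_congr rfl fun y _ => ?_
      by_cases h : y 0 = k
      · simp [h, hk]
      · simp [h]
  refine Eq.trans ?_ (Finset.sum_congr rfl fun k _ => (hrhs k).symm)
  rw [Finset.sum_comm]
  refine Finset.sum_congr rfl fun y _ => ?_
  rw [Finset.sum_ite_eq Finset.univ (y 0), if_pos (Finset.mem_univ _)]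
  refine if_congr (hcond y) ?_ rfl
  rw [Fin.prod_univ_succ]
  simp [Fin.consEquiv]

open Classical in
/-- The probability that the chain started at `i` does not visit `j` in its first `t` steps. -/
noncomputable def survivalProb (P : Matrix S S ℝ≥0∞) (j : S) : ℕ → S → ℝ≥0∞
  | 0, _ => 1
  | t + 1, i => ∑ k with k ≠ j, P i k * survivalProb P j t k

variable {P : Matrix S S ℝ≥0∞} {j : S}

theorem sum_firstPassageProb_add_survivalProb (hP : ∀ i, ∑ k, P i k = 1) (t : ℕ) (i : S) :
    ∑ s ∈ Finset.range t, firstPassageProb P i j (s + 1) + survivalProb P j t i = 1 := by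
  classical
  induction t generalizing i with
  | zero => simp [survivalProb]
  | succ t ih =>
    rw [Finset.sum_range_succ', survivalProb]
    simp only [firstPassageProb_one, firstPassageProb_succ_succ, zero_add]
    rw [Finset.sum_comm, add_right_comm, ← Finset.sum_add_distrib]
    simp only [← Finset.mul_sum, ← mul_add]
    have : ∀ k, ∑ s ∈ Finset.range t, firstPassageProb P k j (s + 1) + survivalProb P j t k = 1 :=
      ih
    simp only [this, mul_one]
    rw [← hP i, ← Finset.sum_filter_add_sum_filter_not Finset.univ (fun k => k ≠ j)]
    congr 1
    simp [Finset.sum_filter]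

open Classical in
/-- The expectation of `H` at time `t` on the event that `j` has not been visited by then. -/
noncomputable def survivalMean (P : Matrix S S ℝ≥0∞) (j : S) (H : S → ℝ≥0∞) : ℕ → S → ℝ≥0∞
  | 0, i => H i
  | t + 1, i => ∑ k with k ≠ j, P i k * survivalMean P j H t k

theorem survivalMean_le (H : S → ℝ≥0∞) (t : ℕ) (i : S) :
    survivalMean P j H t i ≤ (∑ k, H k) * survivalProb P j t i := by
  classical
  induction t generalizing i with
  | zero =>
    simp only [survivalMean, survivalProb, mul_one]
    exact Finset.single_le_sum (f := H) (fun _ _ => zero_le) (Finset.mem_univ i)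
  | succ t ih =>
    rw [survivalMean, survivalProb, Finset.mul_sum]
    refine Finset.sum_le_sum fun k _ => ?_
    rw [mul_left_comm]
    gcongr
    exact ih k

/-- Iterate the first-step equation `t` times; the term `k = j` drops out because `H j = 0`. -/
theorem sum_survivalProb_add_survivalMean {H : S → ℝ≥0∞} (hj : H j = 0)
    (hH : ∀ i, i ≠ j → H i = 1 + ∑ k, P i k * H k) (t : ℕ) (i : S) (hi : i ≠ j) :
    ∑ s ∈ Finset.range t, survivalProb P j s i + survivalMean P j H t i = H i := by
  classical
  induction t generalizing i with
  | zero => simp [survivalMean]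
  | succ t ih =>
    rw [Finset.sum_range_succ', survivalMean]
    simp only [survivalProb]
    rw [Finset.sum_comm, add_right_comm, ← Finset.sum_add_distrib]
    simp only [← Finset.mul_sum, ← mul_add]
    rw [hH i hi, add_comm]
    congr 1
    rw [Finset.sum_filter]
    refine Finset.sum_congr rfl fun k _ => ?_
    by_cases hk : k = j
    · simp [hk, hj]
    · rw [if_pos hk, ih k hk]

/-- A finite solution of the first-step equations is the mean first passage time. -/
theorem meanFirstPassageTime_eq (hP : ∀ i, ∑ k, P i k = 1) {H : S → ℝ≥0∞} (hfin : ∀ i, H i ≠ ⊤)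
    (hj : H j = 0) (hH : ∀ i, i ≠ j → H i = 1 + ∑ k, P i k * H k) (i : S) (hi : i ≠ j) :
    meanFirstPassageTime P i j = H i := by
  classical
  -- Finiteness of `H` makes the survival probabilities summable, so they tend to `0`. This kills
  -- the remainder `survivalMean` and shows that `j` is hit almost surely.
  have hle : ∑' s, survivalProb P j s i ≤ H i := by
    refine ENNReal.tsum_le_of_sum_range_le fun n => ?_
    rw [← sum_survivalProb_add_survivalMean hj hH n i hi]
    exact le_self_add
  have hq : Filter.Tendsto (fun t => survivalProb P j t i) Filter.atTop (nhds 0) :=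
    ENNReal.tendsto_atTop_zero_of_tsum_ne_top (ne_top_of_le_ne_top (hfin i) hle)
  have hr : Filter.Tendsto (fun t => survivalMean P j H t i) Filter.atTop (nhds 0) := by
    have h0 : Filter.Tendsto (fun t => (∑ k, H k) * survivalProb P j t i) Filter.atTop (nhds 0) := by
      have := ENNReal.Tendsto.const_mul (a := ∑ k, H k) hq
        (Or.inr (ENNReal.sum_ne_top.2 fun k _ => hfin k))
      simpa using this
    exact tendsto_of_tendsto_of_tendsto_of_le_of_le tendsto_const_nhds h0
      (fun _ => zero_le) (fun t => survivalMean_le H t i)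
  have hsumq : ∑' s, survivalProb P j s i = H i := by
    have h1 := (ENNReal.tendsto_nat_tsum fun s => survivalProb P j s i).add hr
    simp only [sum_survivalProb_add_survivalMean hj hH _ i hi, add_zero] at h1
    exact tendsto_nhds_unique h1 tendsto_const_nhds
  have hsumf : ∑' t, firstPassageProb P i j (t + 1) = 1 := by
    have h1 := (ENNReal.tendsto_nat_tsum fun t => firstPassageProb P i j (t + 1)).add hq
    simp only [sum_firstPassageProb_add_survivalProb hP _ i, add_zero] at h1
    exact tendsto_nhds_unique h1 tendsto_const_nhds
  have htail : ∀ s, ∑' t, firstPassageProb P i j (t + s + 1) = survivalProb P j s i := by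
    intro s
    have h1 := sum_firstPassageProb_add_survivalProb (j := j) hP s i
    have h2 : ∑ t ∈ Finset.range s, firstPassageProb P i j (t + 1) +
        ∑' t, firstPassageProb P i j (t + s + 1) = 1 := by
      rw [← hsumf]
      exact ENNReal.summable.sum_add_tsum_nat_add'
    refine (ENNReal.add_right_inj ?_).1 (h2.trans h1.symm)
    refine ne_top_of_le_ne_top ENNReal.one_ne_top ?_
    rw [← h1]
    exact le_self_add
  unfold meanFirstPassageTime
  rw [hsumf, tsub_self, mul_zero, add_zero, ← hsumq]
  -- Tail-sum formula: write `t + 1` as the number of `s ≤ t` and exchange the sums.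
  have h1 : ∀ t : ℕ, ((t + 1 : ℕ) : ℝ≥0∞) * firstPassageProb P i j (t + 1)
      = ∑' s : ℕ, if s ≤ t then firstPassageProb P i j (t + 1) else 0 := by
    intro t
    rw [tsum_eq_sum (s := Finset.range (t + 1)) (by
      intro s hs
      rw [Finset.mem_range] at hs
      exact if_neg (by omega))]
    rw [Finset.sum_congr rfl (g := fun _ => firstPassageProb P i j (t + 1)) (by
      intro s hs
      rw [Finset.mem_range] at hs
      exact if_pos (by omega))]
    simp
  simp only [h1]
  rw [ENNReal.tsum_comm]
  refine tsum_congr fun s => ?_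
  rw [← htail s, ← ENNReal.summable.sum_add_tsum_nat_add' (k := s)]
  rw [Finset.sum_eq_zero, zero_add]
  · refine tsum_congr fun t => ?_
    rw [if_pos (by omega)]
  · intro t ht
    rw [Finset.mem_range] at ht
    exact if_neg (by omega)

end FirstPassage

/-! ### Tree metrics, hitting times and the Wiener index -/

/-- `d` has the combinatorial properties of the distance function of the tree `G`. -/
structure IsTreeMetric {W : Type u} (G : SimpleGraph W) (d : W → W → ℕ) : Prop where
  self : ∀ x, d x x = 0
  comm : ∀ x y, d x y = d y x
  triangle : ∀ x y z, d x z ≤ d x y + d y z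
  step : ∀ x y z, G.Adj x y → d y z = d x z + 1 ∨ d y z + 1 = d x z
  existsUnique : ∀ x z, x ≠ z → ∃! y, G.Adj x y ∧ d y z + 1 = d x z

theorem _root_.SimpleGraph.IsTree.isTreeMetric_dist {W : Type u} {G : SimpleGraph W}
    (hG : G.IsTree) : IsTreeMetric G G.dist where
  self x := SimpleGraph.dist_self
  comm x y := SimpleGraph.dist_comm
  triangle x y z := hG.connected.dist_triangle
  step x y z h := by
    have h1 := hG.dist_ne_of_adj z h
    have h2 := hG.connected.dist_triangle (u := z) (v := x) (w := y)
    have h3 := hG.connected.dist_triangle (u := z) (v := y) (w := x)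
    rw [SimpleGraph.dist_eq_one_iff_adj.2 h] at h2
    rw [SimpleGraph.dist_eq_one_iff_adj.2 h.symm] at h3
    rw [SimpleGraph.dist_comm (u := y), SimpleGraph.dist_comm (u := x)]
    omega
  existsUnique x z hxz := by
    obtain ⟨p, hp⟩ := hG.connected.exists_walk_length_eq_dist x z
    cases p with
    | nil => exact absurd rfl hxz
    | @cons _ y _ h q =>
      have hq : G.dist y z + 1 = G.dist x z := by
        rw [SimpleGraph.Walk.length_cons] at hp
        have h1 := SimpleGraph.dist_le q
        have h2 := hG.connected.dist_triangle (u := x) (v := y) (w := z)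
        rw [SimpleGraph.dist_eq_one_iff_adj.2 h] at h2
        omega
      refine ⟨y, ⟨h, hq⟩, ?_⟩
      rintro y' ⟨h', hy'⟩
      obtain ⟨q', hq'⟩ := hG.connected.exists_walk_length_eq_dist y' z
      have hp1 := SimpleGraph.Walk.isPath_of_length_eq_dist _ hp
      have hp2 := SimpleGraph.Walk.isPath_of_length_eq_dist (SimpleGraph.Walk.cons h' q')
        (by rw [SimpleGraph.Walk.length_cons, hq', hy'])
      have := (hG.existsUnique_path x z).unique hp1 hp2
      have := congrArg SimpleGraph.Walk.snd this
      simpa using this.symm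

namespace IsTreeMetric

section

variable {W : Type u} {G : SimpleGraph W} {d : W → W → ℕ}

theorem eq_of_dist_eq_zero (h : IsTreeMetric G d) {x y : W} (hxy : d x y = 0) : x = y := by
  by_contra hne
  obtain ⟨w, ⟨-, hw⟩, -⟩ := h.existsUnique x y hne
  omega

theorem dist_of_adj (h : IsTreeMetric G d) {x y : W} (hxy : G.Adj x y) : d x y = 1 := by
  have h1 := h.step x y x hxy
  have h2 := h.self x
  have h3 := h.comm x y
  omega

end

variable {W : Type u} [Fintype W] {G : SimpleGraph W} {d : W → W → ℕ}

open Classical in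
-- One neighbour of `i` is a step closer to `z` and the others a step further; at `i = z` none is
-- closer, whence the correction `2`.
theorem sum_neighborFinset (h : IsTreeMetric G d) (i z : W) :
    ∑ k ∈ G.neighborFinset i, (d k z : ℝ)
      = G.degree i * d i z + G.degree i - 2 + if i = z then 2 else 0 := by
  rw [← G.card_neighborFinset_eq_degree]
  by_cases hiz : i = z
  · subst hiz
    rw [if_pos rfl, h.self, Finset.sum_congr rfl (g := fun _ => (1 : ℝ))]
    · simp
    · intro k hk
      rw [h.comm, h.dist_of_adj (by simpa using hk)]
      simp
  · rw [if_neg hiz]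
    obtain ⟨y, ⟨hy, hyz⟩, huniq⟩ := h.existsUnique i z hiz
    rw [Finset.sum_congr rfl (g := fun k => ((d i z : ℝ) + 1) - if k = y then 2 else 0)]
    · rw [Finset.sum_sub_distrib, Finset.sum_ite_eq', if_pos (by simpa using hy)]
      simp
    · intro k hk
      have hk : G.Adj i k := by simpa using hk
      by_cases hky : k = y
      · subst hky
        rw [if_pos rfl, ← hyz]
        push_cast
        ring
      · rw [if_neg hky]
        rcases h.step i k z hk with h1 | h1
        · rw [h1]; push_cast; ring
        · exact absurd (huniq k ⟨hk, h1⟩) hky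

open Classical in
theorem sum_neighborFinset_sq (h : IsTreeMetric G d) (i z : W) :
    ∑ k ∈ G.neighborFinset i, (d k z : ℝ) ^ 2
      = G.degree i * (d i z : ℝ) ^ 2 + 2 * d i z * (G.degree i - 2) + G.degree i := by
  rw [← G.card_neighborFinset_eq_degree]
  by_cases hiz : i = z
  · subst hiz
    rw [h.self, Finset.sum_congr rfl (g := fun _ => (1 : ℝ))]
    · simp
    · intro k hk
      rw [h.comm, h.dist_of_adj (by simpa using hk)]
      simp
  · obtain ⟨y, ⟨hy, hyz⟩, huniq⟩ := h.existsUnique i z hiz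
    rw [Finset.sum_congr rfl
      (g := fun k => ((d i z : ℝ) + 1) ^ 2 - if k = y then 4 * (d i z : ℝ) else 0)]
    · rw [Finset.sum_sub_distrib, Finset.sum_ite_eq', if_pos (by simpa using hy)]
      simp
      ring
    · intro k hk
      have hk : G.Adj i k := by simpa using hk
      by_cases hky : k = y
      · subst hky
        rw [if_pos rfl, ← hyz]
        push_cast
        ring
      · rw [if_neg hky]
        rcases h.step i k z hk with h1 | h1
        · rw [h1]; push_cast; ring
        · exact absurd (huniq k ⟨hk, h1⟩) hky

open Classical in
theorem _root_.SimpleGraph.sum_sum_neighborFinset (G : SimpleGraph W) (f : W → ℝ) :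
    ∑ i, ∑ k ∈ G.neighborFinset i, f k = ∑ i, G.degree i * f i := by
  rw [Finset.sum_comm' (t' := Finset.univ) (s' := fun k => G.neighborFinset k)]
  · simp
  · intro x y
    simp [G.adj_comm]

open Classical in
theorem sum_degree (h : IsTreeMetric G d) [Nonempty W] :
    ∑ i, (G.degree i : ℝ) = 2 * ((Fintype.card W : ℝ) - 1) := by
  obtain ⟨z⟩ := ‹Nonempty W›
  have h1 := G.sum_sum_neighborFinset fun k => (d k z : ℝ)
  simp only [h.sum_neighborFinset, Finset.sum_add_distrib, Finset.sum_sub_distrib] at h1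
  simp at h1
  linarith

open Classical in
-- Double counting of the squared distances over adjacent pairs: the quadratic terms cancel and
-- leave this linear relation.
theorem sum_degree_mul (h : IsTreeMetric G d) (z : W) :
    ∑ i, (G.degree i : ℝ) * d i z = 2 * ∑ i, (d i z : ℝ) - ((Fintype.card W : ℝ) - 1) := by
  have : Nonempty W := ⟨z⟩
  have h1 := G.sum_sum_neighborFinset fun k => (d k z : ℝ) ^ 2
  have h2 : ∀ i, 2 * (d i z : ℝ) * (G.degree i - 2)
      = 2 * (G.degree i * d i z) - 4 * d i z := fun i => by ring
  simp only [h.sum_neighborFinset_sq, Finset.sum_add_distrib, h2, Finset.sum_sub_distrib,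
    h.sum_degree, ← Finset.mul_sum] at h1
  linarith

open Classical in
/-- The hitting time of the simple random walk on a tree. -/
noncomputable def hittingTime (G : SimpleGraph W) (d : W → W → ℕ) (i j : W) : ℝ :=
  ∑ z, (G.degree z : ℝ) * ((d i j + d z j - d i z) / 2)

theorem hittingTime_nonneg (h : IsTreeMetric G d) (i j : W) : 0 ≤ hittingTime G d i j := by
  refine Finset.sum_nonneg fun z _ => mul_nonneg (Nat.cast_nonneg _) ?_
  have h1 := h.triangle i j z
  rw [h.comm j z] at h1
  have h2 : (d i z : ℝ) ≤ d i j + d z j := by exact_mod_cast h1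
  linarith

theorem hittingTime_self (h : IsTreeMetric G d) (j : W) : hittingTime G d j j = 0 := by
  refine Finset.sum_eq_zero fun z _ => ?_
  rw [h.self, h.comm z j]
  simp

open Classical in
-- When the Gromov product in `hittingTime` is summed over the neighbours of `i`, the drifts of `d ·
-- j` and `d · z` cancel except at `z = i`, where the weight `deg z` supplies the term `deg i`.
theorem degree_mul_hittingTime (h : IsTreeMetric G d) {i j : W} (hij : i ≠ j) :
    G.degree i * hittingTime G d i j
      = G.degree i + ∑ k ∈ G.neighborFinset i, hittingTime G d k j := by
  unfold hittingTime
  rw [Finset.sum_comm]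
  simp only [← Finset.mul_sum, ← Finset.sum_div, Finset.sum_add_distrib, Finset.sum_sub_distrib,
    h.sum_neighborFinset, if_neg hij, Finset.sum_const, G.card_neighborFinset_eq_degree,
    nsmul_eq_mul]
  have h1 : (G.degree i : ℝ) = ∑ z, (G.degree z : ℝ) * if i = z then 1 else 0 := by simp
  conv_rhs => lhs; rw [h1]
  rw [Finset.mul_sum, ← Finset.sum_add_distrib]
  refine Finset.sum_congr rfl fun z _ => ?_
  split_ifs <;> ring

open Classical in
theorem degree_pos (h : IsTreeMetric G d) (hW : 2 ≤ Fintype.card W) (i : W) : 0 < G.degree i := by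
  have : Nontrivial W := Fintype.one_lt_card_iff_nontrivial.1 hW
  obtain ⟨z, hz⟩ := exists_ne i
  obtain ⟨y, ⟨hy, -⟩, -⟩ := h.existsUnique i z hz.symm
  exact (G.degree_pos_iff_exists_adj i).2 ⟨y, hy⟩

open Classical in
theorem sum_walkMatrix_mul (i : W) (f : W → ℝ≥0∞) :
    ∑ k, walkMatrix G i k * f k = (G.degree i : ℝ≥0∞)⁻¹ * ∑ k ∈ G.neighborFinset i, f k := by
  rw [Finset.mul_sum, SimpleGraph.neighborFinset_eq_filter, Finset.sum_filter]
  refine Finset.sum_congr rfl fun k _ => ?_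
  unfold walkMatrix
  split_ifs <;> simp

theorem meanFirstPassageTime_walkMatrix (h : IsTreeMetric G d) (hW : 2 ≤ Fintype.card W)
    {i j : W} (hij : i ≠ j) :
    meanFirstPassageTime (walkMatrix G) i j = ENNReal.ofReal (hittingTime G d i j) := by
  classical
  have hd0 : ∀ i, (G.degree i : ℝ≥0∞) ≠ 0 := fun i => by
    exact_mod_cast (h.degree_pos hW i).ne'
  refine meanFirstPassageTime_eq (H := fun i => ENNReal.ofReal (hittingTime G d i j)) ?_ ?_ ?_ ?_ i
    hij
  · intro i
    have h1 : ∑ k, walkMatrix G i k = ∑ k, walkMatrix G i k * (fun _ => 1) k :=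
      Finset.sum_congr rfl fun k _ => (mul_one _).symm
    rw [h1, sum_walkMatrix_mul, Finset.sum_const, G.card_neighborFinset_eq_degree,
      nsmul_eq_mul, mul_one, ENNReal.inv_mul_cancel (hd0 i) (ENNReal.natCast_ne_top _)]
  · exact fun _ => ENNReal.ofReal_ne_top
  · simp only [h.hittingTime_self, ENNReal.ofReal_zero]
  · intro i hi
    have h1 := congrArg ENNReal.ofReal (h.degree_mul_hittingTime hi)
    rw [ENNReal.ofReal_mul (Nat.cast_nonneg _), ENNReal.ofReal_add (Nat.cast_nonneg _)
      (Finset.sum_nonneg fun k _ => h.hittingTime_nonneg k j), ENNReal.ofReal_natCast,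
      ENNReal.ofReal_sum_of_nonneg fun k _ => h.hittingTime_nonneg k j] at h1
    rw [sum_walkMatrix_mul]
    have h2 := congrArg (fun x => (G.degree i : ℝ≥0∞)⁻¹ * x) h1
    rw [← mul_assoc, mul_add, ENNReal.inv_mul_cancel (hd0 i) (ENNReal.natCast_ne_top _),
      one_mul] at h2
    exact h2

open Classical in
theorem sum_degree_mul_degree_mul (h : IsTreeMetric G d) [Nonempty W] :
    ∑ i, ∑ j, (G.degree i : ℝ) * G.degree j * d i j
      = 4 * ∑ i, ∑ j, (d i j : ℝ)
        - 2 * ((Fintype.card W : ℝ) - 1) * (2 * (Fintype.card W : ℝ) - 1) := by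
  have h1 : ∑ j, (G.degree j : ℝ) * ∑ i, (d i j : ℝ)
      = 2 * ∑ i, ∑ j, (d i j : ℝ) - Fintype.card W * ((Fintype.card W : ℝ) - 1) := by
    calc ∑ j, (G.degree j : ℝ) * ∑ i, (d i j : ℝ)
        = ∑ i, ∑ j, (G.degree j : ℝ) * d j i := by
          simp only [Finset.mul_sum]
          rw [Finset.sum_comm]
          exact Finset.sum_congr rfl fun i _ => Finset.sum_congr rfl fun j _ => by rw [h.comm i j]
      _ = _ := by
          simp only [h.sum_degree_mul, Finset.sum_sub_distrib, ← Finset.mul_sum]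
          rw [Finset.sum_comm]
          simp
          ring
  calc ∑ i, ∑ j, (G.degree i : ℝ) * G.degree j * d i j
      = ∑ j, (G.degree j : ℝ) * ∑ i, (G.degree i : ℝ) * d i j := by
        rw [Finset.sum_comm]
        simp only [Finset.mul_sum]
        exact Finset.sum_congr rfl fun i _ => Finset.sum_congr rfl fun j _ => by ring
    _ = 2 * ∑ j, (G.degree j : ℝ) * ∑ i, (d i j : ℝ)
          - ((Fintype.card W : ℝ) - 1) * ∑ j, (G.degree j : ℝ) := by
        simp only [h.sum_degree_mul]
        rw [Finset.mul_sum, Finset.mul_sum, ← Finset.sum_sub_distrib]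
        exact Finset.sum_congr rfl fun i _ => by ring
    _ = _ := by rw [h1, h.sum_degree]; ring

open Classical in
-- Each of the three distances in `hittingTime` gives the same triple sum `M * S`, two with sign
-- plus and one with minus. The diagonal is harmless, since `hittingTime` vanishes there.
theorem kemeny_eq_degree_sum (h : IsTreeMetric G d) (hW : 2 ≤ Fintype.card W) :
    kemeny G = ENNReal.ofReal ((∑ i, ∑ j, (G.degree i : ℝ) * G.degree j * d i j)
      / (2 * ∑ i, (G.degree i : ℝ))) := by
  have : Nonempty W := Fintype.card_pos_iff.1 (by omega)
  set M : ℝ := ∑ i, (G.degree i : ℝ) with hM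
  have hM0 : 0 < M := Finset.sum_pos (fun i _ => by exact_mod_cast h.degree_pos hW i)
    Finset.univ_nonempty
  have hM2 : M = 2 * (G.edgeFinset.card : ℝ) := by
    rw [hM]
    exact_mod_cast G.sum_degrees_eq_twice_card_edges
  have hπ : ∀ v, walkStationary G v = ENNReal.ofReal (G.degree v / M) := by
    intro v
    unfold walkStationary
    rw [ENNReal.ofReal_div_of_pos hM0, hM2, ENNReal.ofReal_mul (by norm_num)]
    simp
  have hterm : ∀ i j, i ≠ j → walkStationary G i * meanFirstPassageTime (walkMatrix G) i j
      * walkStationary G j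
      = ENNReal.ofReal (G.degree i / M * hittingTime G d i j * (G.degree j / M)) := by
    intro i j hij
    have hH := h.hittingTime_nonneg i j
    rw [h.meanFirstPassageTime_walkMatrix hW hij, hπ, hπ, ← ENNReal.ofReal_mul (by positivity),
      ← ENNReal.ofReal_mul (by positivity)]
  have hnn : ∀ i j, 0 ≤ G.degree i / M * hittingTime G d i j * (G.degree j / M) := fun i j => by
    have hH := h.hittingTime_nonneg i j
    positivity
  have hsum : kemeny G = ENNReal.ofReal
      (∑ i, ∑ j, G.degree i / M * hittingTime G d i j * (G.degree j / M)) := by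
    rw [ENNReal.ofReal_sum_of_nonneg fun i _ => Finset.sum_nonneg fun j _ => hnn i j]
    unfold kemeny kemenyOf
    refine Finset.sum_congr rfl fun i _ => ?_
    rw [ENNReal.ofReal_sum_of_nonneg fun j _ => hnn i j, Finset.sum_filter]
    refine Finset.sum_congr rfl fun j _ => ?_
    by_cases hij : j = i
    · simp [hij, h.hittingTime_self]
    · rw [if_pos hij, hterm i j (Ne.symm hij)]
  rw [hsum]
  congr 1
  set a : W → ℝ := fun i => (G.degree i : ℝ) with ha
  set S : ℝ := ∑ i, ∑ j, a i * a j * d i j with hS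
  have e1 : ∑ i, ∑ j, ∑ z, a i * a j * a z * (d i j : ℝ) = M * S := by
    rw [hS, Finset.mul_sum]
    refine Finset.sum_congr rfl fun i _ => ?_
    rw [Finset.mul_sum]
    refine Finset.sum_congr rfl fun j _ => ?_
    rw [hM, Finset.sum_mul]
    exact Finset.sum_congr rfl fun z _ => by ring
  have e2 : ∑ i, ∑ j, ∑ z, a i * a j * a z * (d i z : ℝ) = M * S := by
    rw [← e1]
    refine Finset.sum_congr rfl fun i _ => ?_
    rw [Finset.sum_comm]
    exact Finset.sum_congr rfl fun j _ => Finset.sum_congr rfl fun z _ => by ring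
  have e3 : ∑ i, ∑ j, ∑ z, a i * a j * a z * (d z j : ℝ) = M * S := by
    rw [← e1, Finset.sum_comm]
    calc ∑ j, ∑ i, ∑ z, a i * a j * a z * (d z j : ℝ)
        = ∑ j, ∑ z, ∑ i, a i * a j * a z * (d z j : ℝ) :=
          Finset.sum_congr rfl fun j _ => Finset.sum_comm
      _ = _ := Finset.sum_congr rfl fun j _ => Finset.sum_congr rfl fun z _ =>
          Finset.sum_congr rfl fun i _ => by rw [h.comm z j]; ring
  have e4 : ∑ i, ∑ j, a i / M * hittingTime G d i j * (a j / M)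
      = 1 / (2 * M ^ 2) * (∑ i, ∑ j, ∑ z, a i * a j * a z * (d i j : ℝ)
        + ∑ i, ∑ j, ∑ z, a i * a j * a z * (d z j : ℝ)
        - ∑ i, ∑ j, ∑ z, a i * a j * a z * (d i z : ℝ)) := by
    simp only [hittingTime, ← Finset.sum_add_distrib, ← Finset.sum_sub_distrib, Finset.mul_sum,
      Finset.sum_mul]
    refine Finset.sum_congr rfl fun i _ => Finset.sum_congr rfl fun j _ =>
      Finset.sum_congr rfl fun z _ => ?_
    simp only [ha]
    field_simp
  rw [e4, e1, e2, e3]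
  field_simp
  ring

/-- Kemeny's constant of a tree is an increasing affine function of its Wiener index. -/
theorem exists_kemeny_eq (h : IsTreeMetric G d) (hW : 2 ≤ Fintype.card W) :
    ∃ r : ℝ, 0 ≤ r ∧ kemeny G = ENNReal.ofReal r ∧
      4 * ((Fintype.card W : ℝ) - 1) * r = 4 * ((∑ i, ∑ j, d i j : ℕ) : ℝ)
        - 2 * ((Fintype.card W : ℝ) - 1) * (2 * (Fintype.card W : ℝ) - 1) := by
  classical
  have : Nonempty W := Fintype.card_pos_iff.1 (by omega)
  refine ⟨_, ?_, h.kemeny_eq_degree_sum hW, ?_⟩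
  · positivity
  · have hN : (2 : ℝ) ≤ Fintype.card W := by exact_mod_cast hW
    have hN1 : (Fintype.card W : ℝ) - 1 ≠ 0 := by linarith
    rw [h.sum_degree, h.sum_degree_mul_degree_mul]
    push_cast
    field_simp
    ring

end IsTreeMetric

theorem kemeny_le_kemeny_iff {W : Type u} [Fintype W] {G G' : SimpleGraph W} {d d' : W → W → ℕ}
    (h : IsTreeMetric G d) (h' : IsTreeMetric G' d') (hW : 2 ≤ Fintype.card W) :
    kemeny G ≤ kemeny G' ↔ ∑ i, ∑ j, d i j ≤ ∑ i, ∑ j, d' i j := by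
  obtain ⟨r, -, hr, e⟩ := h.exists_kemeny_eq hW
  obtain ⟨r', h0, hr', e'⟩ := h'.exists_kemeny_eq hW
  have hN : (2 : ℝ) ≤ Fintype.card W := by exact_mod_cast hW
  rw [hr, hr', ENNReal.ofReal_le_ofReal_iff h0, ← Nat.cast_le (α := ℝ)]
  constructor
  · intro hle
    have := mul_le_mul_of_nonneg_left hle (by linarith : 0 ≤ 4 * ((Fintype.card W : ℝ) - 1))
    linarith
  · intro hle
    refine le_of_mul_le_mul_left ?_ (by linarith : 0 < 4 * ((Fintype.card W : ℝ) - 1))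
    linarith

/-! ### The first step towards a vertex -/

namespace IsTreeMetric

section Next

variable {W : Type u} {G : SimpleGraph W} {d : W → W → ℕ} (h : IsTreeMetric G d)

/-- The neighbour of `x` on the path from `x` to `z`. -/
noncomputable def next {x z : W} (hxz : x ≠ z) : W := (h.existsUnique x z hxz).choose

theorem adj_next {x z : W} (hxz : x ≠ z) : G.Adj x (h.next hxz) :=
  (h.existsUnique x z hxz).choose_spec.1.1

theorem dist_next {x z : W} (hxz : x ≠ z) : d (h.next hxz) z + 1 = d x z :=
  (h.existsUnique x z hxz).choose_spec.1.2

theorem eq_next {x y z : W} (hxz : x ≠ z) (hxy : G.Adj x y) (hy : d y z + 1 = d x z) :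
    y = h.next hxz :=
  (h.existsUnique x z hxz).choose_spec.2 y ⟨hxy, hy⟩

theorem next_of_adj {x z : W} (hxz : G.Adj x z) : h.next hxz.ne = z :=
  (h.eq_next _ hxz (by rw [h.self, h.dist_of_adj hxz])).symm

/-- By the triangle inequality, a step from `x` towards the nearer of `y`, `z` is also a step
towards the farther one. -/
theorem next_congr {x y z : W} (hyz : G.Adj y z) (hxy : x ≠ y) (hxz : x ≠ z) :
    h.next hxy = h.next hxz := by
  have e1 := h.dist_next hxy
  have e2 := h.dist_next hxz
  have t1 := h.triangle (h.next hxy) y z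
  have t2 := h.triangle (h.next hxz) z y
  have hd := h.dist_of_adj hyz
  have hd' := h.dist_of_adj hyz.symm
  have s := h.step y z x hyz
  rw [h.comm z x, h.comm y x] at s
  rcases s with s | s
  · refine h.eq_next hxz (h.adj_next hxy) ?_
    have := h.step x _ z (h.adj_next hxy)
    omega
  · refine (h.eq_next hxy (h.adj_next hxz) ?_).symm
    have := h.step x _ y (h.adj_next hxz)
    omega

end Next

end IsTreeMetric

/-! ### The distance function of a chain -/

namespace TreeChain

variable {ι : Type u} {T : SimpleGraph ι} {V : ι → Type v} {G : ∀ i, SimpleGraph (V i)}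

theorem vertex_congr (C : TreeChain T G) {i j j' : ι} (hj : j = j') (h : T.Adj i j)
    (h' : T.Adj i j') : C.vertex i j h = C.vertex i j' h' := by
  subst hj
  rfl

theorem graph_adj_mk_iff (C : TreeChain T G) {i : ι} {a : V i} {y : Σ i, V i} :
    C.graph.Adj ⟨i, a⟩ y ↔ (∃ b, (G i).Adj a b ∧ y = ⟨i, b⟩) ∨
      ∃ j, ∃ h : T.Adj i j, a = C.vertex i j h ∧ y = ⟨j, C.vertex j i h.symm⟩ := by
  constructor
  · rintro (⟨k, b, c, hbc, hb, rfl⟩ | ⟨k, j, h, he⟩)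
    · cases hb
      exact Or.inl ⟨c, hbc, rfl⟩
    · right
      rw [Sym2.eq_iff] at he
      rcases he with ⟨h1, rfl⟩ | ⟨h1, rfl⟩
      · cases h1
        exact ⟨j, h, rfl, rfl⟩
      · cases h1
        exact ⟨k, h.symm, rfl, rfl⟩
  · rintro (⟨b, hab, rfl⟩ | ⟨j, h, rfl, rfl⟩)
    · exact Or.inl ⟨i, a, b, hab, rfl, rfl⟩
    · exact Or.inr ⟨i, j, h, rfl⟩

variable {dT : ι → ι → ℕ} (hT : IsTreeMetric T dT) (C : TreeChain T G)

open Classical in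
/-- The vertex of block `l` nearest to a vertex of the chain. -/
noncomputable def proj (l : ι) (x : Σ i, V i) : V l :=
  if h : x.1 = l then h ▸ x.2 else C.vertex l (hT.next (Ne.symm h)) (hT.adj_next (Ne.symm h))

theorem proj_mk_self (l : ι) (a : V l) : C.proj hT l ⟨l, a⟩ = a := by
  simp [proj]

theorem proj_mk_of_ne {l i : ι} (h : l ≠ i) (a : V i) :
    C.proj hT l ⟨i, a⟩ = C.vertex l (hT.next h) (hT.adj_next h) := by
  unfold proj
  rw [dif_neg h.symm]

theorem proj_mk_of_adj {l i : ι} (h : T.Adj l i) (a : V i) :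
    C.proj hT l ⟨i, a⟩ = C.vertex l i h := by
  rw [proj_mk_of_ne hT C h.ne]
  exact C.vertex_congr (hT.next_of_adj h) _ _

/-- Seen from any third block, `i` and `j` lie in the same direction of `T`. Hence crossing a bridge
changes only the `dT` term of `chainDist`. -/
theorem proj_bridge {i j : ι} (h : T.Adj i j) (l : ι) :
    C.proj hT l ⟨i, C.vertex i j h⟩ = C.proj hT l ⟨j, C.vertex j i h.symm⟩ := by
  by_cases hi : l = i
  · subst hi
    rw [proj_mk_self, proj_mk_of_adj hT C h]
  by_cases hj : l = j
  · subst hj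
    rw [proj_mk_self, proj_mk_of_adj hT C h.symm]
  rw [proj_mk_of_ne hT C hi, proj_mk_of_ne hT C hj]
  exact C.vertex_congr (hT.next_congr h hi hj) _ _

variable [Fintype ι] (d : ∀ i, V i → V i → ℕ)

/-- The distance function of a chain, in terms of those of the blocks. -/
noncomputable def chainDist (x y : Σ i, V i) : ℕ :=
  dT x.1 y.1 + ∑ l, d l (C.proj hT l x) (C.proj hT l y)

/-- A move inside block `i` leaves every other projection fixed. The additive form avoids truncated
subtraction. -/
theorem chainDist_block {i : ι} (a b : V i) (z : Σ i, V i) :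
    C.chainDist hT d ⟨i, b⟩ z + d i a (C.proj hT i z)
      = C.chainDist hT d ⟨i, a⟩ z + d i b (C.proj hT i z) := by
  classical
  unfold chainDist
  rw [← Finset.add_sum_erase _ _ (Finset.mem_univ i),
    ← Finset.add_sum_erase _ _ (Finset.mem_univ i), proj_mk_self, proj_mk_self]
  have : ∀ l ∈ Finset.univ.erase i, d l (C.proj hT l ⟨i, b⟩) (C.proj hT l z)
      = d l (C.proj hT l ⟨i, a⟩) (C.proj hT l z) := by
    intro l hl
    have hl := Finset.ne_of_mem_erase hl
    rw [proj_mk_of_ne hT C hl, proj_mk_of_ne hT C hl]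
  rw [Finset.sum_congr rfl this]
  ring

theorem chainDist_bridge {i j : ι} (h : T.Adj i j) (z : Σ i, V i) :
    C.chainDist hT d ⟨j, C.vertex j i h.symm⟩ z + dT i z.1
      = C.chainDist hT d ⟨i, C.vertex i j h⟩ z + dT j z.1 := by
  unfold chainDist
  simp only [proj_bridge hT C h]
  ring

theorem isTreeMetric_chainDist {d} (hd : ∀ i, IsTreeMetric (G i) (d i)) :
    IsTreeMetric C.graph (C.chainDist hT d) where
  self x := by simp [chainDist, hT.self, (hd _).self]
  comm x y := by
    unfold chainDist
    rw [hT.comm]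
    congr 1
    exact Finset.sum_congr rfl fun l _ => (hd l).comm _ _
  triangle x y z := by
    unfold chainDist
    have h1 := hT.triangle x.1 y.1 z.1
    have h2 : ∑ l, d l (C.proj hT l x) (C.proj hT l z)
        ≤ ∑ l, (d l (C.proj hT l x) (C.proj hT l y) + d l (C.proj hT l y) (C.proj hT l z)) :=
      Finset.sum_le_sum fun l _ => (hd l).triangle _ _ _
    rw [Finset.sum_add_distrib] at h2
    omega
  step := by
    rintro ⟨i, a⟩ y z hxy
    rcases C.graph_adj_mk_iff.1 hxy with ⟨b, hab, rfl⟩ | ⟨j, h, rfl, rfl⟩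
    · have h1 := C.chainDist_block hT d a b z
      have h2 := (hd i).step a b (C.proj hT i z) hab
      omega
    · have h1 := C.chainDist_bridge hT d h z
      have h2 := hT.step i j z.1 h
      omega
  existsUnique := by
    rintro ⟨i, a⟩ z hxz
    -- If `a` is the projection of `z`, the unique closer neighbour lies across the bridge towards
    -- `z`; otherwise it is the next vertex inside the block.
    by_cases ha : a = C.proj hT i z
    · have hi : i ≠ z.1 := by
        obtain ⟨l, c⟩ := z
        rintro rfl
        rw [proj_mk_self] at ha
        exact hxz (by rw [ha])
      have hv : a = C.vertex i (hT.next hi) (hT.adj_next hi) := by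
        rw [ha]
        exact C.proj_mk_of_ne hT hi z.2
      refine ⟨⟨hT.next hi, C.vertex _ i (hT.adj_next hi).symm⟩,
        ⟨C.graph_adj_mk_iff.2 (Or.inr ⟨_, hT.adj_next hi, hv, rfl⟩), ?_⟩, ?_⟩
      · have h1 := C.chainDist_bridge hT d (hT.adj_next hi) z
        rw [← hv] at h1
        have h2 := hT.dist_next hi
        omega
      · rintro y ⟨hxy, hy⟩
        rcases C.graph_adj_mk_iff.1 hxy with ⟨b, hab, rfl⟩ | ⟨j, h, hj, rfl⟩
        · exfalso
          have h1 := C.chainDist_block hT d a b z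
          rw [← ha, (hd i).self] at h1
          omega
        · have h1 := C.chainDist_bridge hT d h z
          rw [← hj] at h1
          have h2 := hT.eq_next hi h (by omega)
          subst h2
          rfl
    · refine ⟨⟨i, (hd i).next ha⟩,
        ⟨C.graph_adj_mk_iff.2 (Or.inl ⟨_, (hd i).adj_next ha, rfl⟩), ?_⟩, ?_⟩
      · have h1 := C.chainDist_block hT d a ((hd i).next ha) z
        have h2 := (hd i).dist_next ha
        omega
      · rintro y ⟨hxy, hy⟩
        rcases C.graph_adj_mk_iff.1 hxy with ⟨b, hab, rfl⟩ | ⟨j, h, hj, rfl⟩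
        · have h1 := C.chainDist_block hT d a b z
          have h2 := (hd i).eq_next ha hab (by omega)
          rw [h2]
        -- A bridge leading closer to `z` would follow the edge of `T` towards `z`, and its end `a`
        -- would be the projection.
        · exfalso
          have h1 := C.chainDist_bridge hT d h z
          rw [← hj] at h1
          have hi : i ≠ z.1 := fun hi => by
            have := hT.self z.1
            rw [← hi] at this h1
            omega
          have h2 := hT.eq_next hi h (by omega)
          apply ha
          rw [hj, show z = ⟨z.1, z.2⟩ from rfl, C.proj_mk_of_ne hT hi]
          exact C.vertex_congr h2 _ _

end TreeChain

/-! ### Branches and centroids -/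

namespace IsTreeMetric

variable {W : Type u} {G : SimpleGraph W} {d : W → W → ℕ}

/-- If the first step from `v` towards `u` leads away from `w`, then `v` lies between `u` and `w`.
The induction moves `u` one step towards `v`. -/
theorem dist_eq_add_of_next (h : IsTreeMetric G d) {v w : W} (n : ℕ) :
    ∀ u, d u v = n → ∀ huv : v ≠ u, d (h.next huv) w = d v w + 1 → d u w = d u v + d v w := by
  induction n using Nat.strong_induction_on with
  | _ n ih =>
    intro u hn huv hk
    have hd := h.dist_next huv.symm
    have hadj := h.adj_next huv.symm
    obtain ⟨u', hu'⟩ : ∃ u', u' = h.next huv.symm := ⟨_, rfl⟩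
    rw [← hu'] at hd hadj
    by_cases huv' : v = u'
    · subst huv'
      rw [h.next_of_adj hadj.symm] at hk
      rw [hk, h.dist_of_adj hadj, add_comm]
    have hk' : d (h.next huv') w = d v w + 1 := by rwa [h.next_congr hadj.symm huv' huv]
    have e1 := ih (d u' v) (by omega) u' rfl huv' hk'
    rcases h.step u' u w hadj.symm with s | s
    · omega
    -- Otherwise `u` and the next vertex `p` from `u'` towards `v` are both neighbours of `u'`
    -- closer to `w`, so they coincide, although one is farther from `v` than `u'` and the other
    -- nearer.
    exfalso
    have hpd := h.dist_next (Ne.symm huv')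
    have hpa := h.adj_next (Ne.symm huv')
    obtain ⟨p, hp⟩ : ∃ p, p = h.next (Ne.symm huv') := ⟨_, rfl⟩
    rw [← hp] at hpd hpa
    have t := h.triangle p v w
    have st := h.step u' p w hpa
    have hw : u' ≠ w := fun hw => by
      subst hw
      have := h.self u'
      omega
    have h1 := h.eq_next hw hadj.symm s
    have h2 := h.eq_next hw hpa (by omega)
    rw [← h2] at h1
    subst h1
    omega

theorem dist_eq_dist_add_one_iff (h : IsTreeMetric G d) {v k w : W} (hvk : G.Adj v k) :
    d v w = d k w + 1 ↔ ∃ hw : v ≠ w, h.next hw = k := by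
  constructor
  · intro e
    have hw : v ≠ w := fun hw => by
      subst hw
      have := h.self v
      omega
    exact ⟨hw, (h.eq_next hw hvk e.symm).symm⟩
  · rintro ⟨hw, rfl⟩
    exact (h.dist_next hw).symm

theorem reachable_induce_next (h : IsTreeMetric G d) {v : W} (n : ℕ) :
    ∀ w, d w v = n → ∀ hw : v ≠ w, (G.induce ({v}ᶜ : Set W)).Reachable ⟨w, hw.symm⟩
      ⟨h.next hw, (h.adj_next hw).ne'⟩ := by
  induction n using Nat.strong_induction_on with
  | _ n ih =>
    intro w hn hw
    have hd := h.dist_next hw.symm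
    have hadj := h.adj_next hw.symm
    obtain ⟨u, hu⟩ : ∃ u, u = h.next hw.symm := ⟨_, rfl⟩
    rw [← hu] at hd hadj
    by_cases huv : v = u
    · subst huv
      simp only [h.next_of_adj hadj.symm]
      exact SimpleGraph.Reachable.refl _
    · have h1 := ih (d u v) (by omega) u rfl huv
      simp only [h.next_congr hadj.symm huv hw] at h1
      refine SimpleGraph.Reachable.trans (SimpleGraph.Adj.reachable ?_) h1
      simpa using hadj

theorem next_eq_of_reachable_induce (h : IsTreeMetric G d) {v : W} {a b : ({v}ᶜ : Set W)}
    (hab : (G.induce ({v}ᶜ : Set W)).Reachable a b) :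
    h.next (Ne.symm a.2) = h.next (Ne.symm b.2) := by
  obtain ⟨p⟩ := hab
  induction p with
  | nil => rfl
  | @cons a c b hac _ ih =>
    rw [← ih]
    exact h.next_congr (by simpa using hac) _ _

/-- This identifies the components of the tree without `v` with the branches at `v`: an edge
avoiding `v` preserves the direction from `v`, and every vertex is joined to the root of its branch.
-/
theorem reachable_induce_iff (h : IsTreeMetric G d) {v : W} {a b : ({v}ᶜ : Set W)} :
    (G.induce ({v}ᶜ : Set W)).Reachable a b ↔ h.next (Ne.symm a.2) = h.next (Ne.symm b.2) := by
  refine ⟨h.next_eq_of_reachable_induce, fun hab => ?_⟩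
  have h1 := h.reachable_induce_next _ a.1 rfl (Ne.symm a.2)
  have h2 := h.reachable_induce_next _ b.1 rfl (Ne.symm b.2)
  simp only [hab] at h1
  exact h1.trans h2.symm

variable [Fintype W]

/-- The vertices of the branch at `v` through its neighbour `k`. -/
def branch (d : W → W → ℕ) (v k : W) : Finset W := {w | d v w = d k w + 1}

theorem ncard_supp_connectedComponentMk (h : IsTreeMetric G d) {v w : W} (hw : v ≠ w) :
    ((G.induce ({v}ᶜ : Set W)).connectedComponentMk ⟨w, hw.symm⟩).supp.ncard
      = (branch d v (h.next hw)).card := by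
  rw [← Set.ncard_image_of_injective _ Subtype.val_injective, ← Set.ncard_coe_finset]
  congr 1
  ext x
  simp only [Set.mem_image, SimpleGraph.ConnectedComponent.mem_supp_iff,
    SimpleGraph.ConnectedComponent.eq, branch, Finset.coe_filter, Finset.mem_univ, true_and,
    Set.mem_ofPred_eq, h.dist_eq_dist_add_one_iff (h.adj_next hw), h.reachable_induce_iff]
  constructor
  · rintro ⟨y, hy, rfl⟩
    exact ⟨Ne.symm y.2, hy⟩
  · rintro ⟨hx, e⟩
    exact ⟨⟨x, hx.symm⟩, e, rfl⟩

theorem isCentroid_iff_branch (h : IsTreeMetric G d) (v : W) :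
    IsCentroid G v ↔ ∀ k, G.Adj v k → 2 * (branch d v k).card ≤ Fintype.card W := by
  constructor
  · intro hc k hk
    have h1 := hc ((G.induce ({v}ᶜ : Set W)).connectedComponentMk ⟨k, hk.ne'⟩)
    rw [h.ncard_supp_connectedComponentMk hk.ne, h.next_of_adj hk] at h1
    omega
  · intro hb c
    induction c using SimpleGraph.ConnectedComponent.ind with
    | _ w =>
      obtain ⟨w, hw⟩ := w
      rw [h.ncard_supp_connectedComponentMk (Ne.symm hw)]
      have := hb _ (h.adj_next (Ne.symm hw))
      omega

theorem sum_dist_add_card (h : IsTreeMetric G d) {v k : W} (hvk : G.Adj v k) :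
    ∑ w, d v w + Fintype.card W = ∑ w, d k w + 2 * (branch d v k).card := by
  have h1 : ∀ w, d v w + 1 = d k w + 2 * if d v w = d k w + 1 then 1 else 0 := by
    intro w
    have := h.step v k w hvk
    split_ifs <;> omega
  have h2 := Finset.sum_congr (rfl : (Finset.univ : Finset W) = Finset.univ) fun w _ => h1 w
  rw [Finset.sum_add_distrib, Finset.sum_add_distrib, ← Finset.mul_sum,
    ← Finset.card_filter] at h2
  simpa [branch] using h2

/-- Moving from `v` to `u` adds exactly `d u v` to distances off the branch containing `u` and
removes at most `d u v` on it. That branch has at most half of the vertices. -/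
theorem sum_dist_le_of_branch (h : IsTreeMetric G d) {u v : W} (huv : v ≠ u)
    (hb : 2 * (branch d v (h.next huv)).card ≤ Fintype.card W) : ∑ w, d v w ≤ ∑ w, d u w := by
  have h1 : ∀ w, d v w + d u v
      ≤ d u w + 2 * d u v * if d v w = d (h.next huv) w + 1 then 1 else 0 := by
    intro w
    split_ifs with hw
    · have t := h.triangle v u w
      rw [h.comm v u] at t
      omega
    · have s := h.step v _ w (h.adj_next huv)
      have := h.dist_eq_add_of_next (w := w) _ u rfl huv (by omega)
      omega
  have h2 := Finset.sum_le_sum fun w (_ : w ∈ Finset.univ) => h1 w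
  rw [Finset.sum_add_distrib, Finset.sum_add_distrib, ← Finset.mul_sum,
    ← Finset.card_filter, Finset.sum_const, Finset.card_univ, smul_eq_mul] at h2
  have h3 : d u v * (2 * (branch d v (h.next huv)).card) ≤ d u v * Fintype.card W :=
    Nat.mul_le_mul_left _ hb
  unfold branch at h3
  linarith

/-- The centroids of a tree are the vertices that minimise the sum of the distances. -/
theorem isCentroid_iff (h : IsTreeMetric G d) (v : W) :
    IsCentroid G v ↔ ∀ u, ∑ w, d v w ≤ ∑ w, d u w := by
  rw [h.isCentroid_iff_branch]
  constructor
  · intro hb u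
    by_cases huv : v = u
    · rw [huv]
    · exact h.sum_dist_le_of_branch huv (hb _ (h.adj_next huv))
  · intro hm k hk
    have h1 := h.sum_dist_add_card hk
    have h2 := hm k
    omega

end IsTreeMetric

/-! ### Minimising the Wiener index block by block -/

namespace TreeChain

section Bridges

variable {ι : Type u} {T : SimpleGraph ι} {V : ι → Type v} {G : ∀ i, SimpleGraph (V i)}
  (C : TreeChain T G)

theorem mem_bridgeVertices_iff {i : ι} {a : V i} :
    a ∈ C.bridgeVertices i ↔ ∃ j h, a = C.vertex i j h := by
  constructor
  · rintro ⟨e, ⟨k, j, h, rfl⟩, ha⟩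
    rcases Sym2.mem_iff.1 ha with h1 | h1
    · cases h1
      exact ⟨j, h, rfl⟩
    · cases h1
      exact ⟨k, h.symm, rfl⟩
  · rintro ⟨j, h, rfl⟩
    exact ⟨_, ⟨i, j, h, rfl⟩, Sym2.mem_mk_left _ _⟩

theorem forall_bridges_isCentroid_iff [∀ i, Fintype (V i)] :
    (∀ x y : Σ i, V i, s(x, y) ∈ C.bridges →
      IsCentroid (G x.1) x.2 ∧ IsCentroid (G y.1) y.2) ↔
      ∀ i j h, IsCentroid (G i) (C.vertex i j h) := by
  constructor
  · intro hc i j h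
    exact (hc ⟨i, _⟩ ⟨j, _⟩ ⟨i, j, h, rfl⟩).1
  · rintro hc x y ⟨i, j, h, he⟩
    rcases Sym2.eq_iff.1 he with ⟨rfl, rfl⟩ | ⟨rfl, rfl⟩
    · exact ⟨hc i j h, hc j i h.symm⟩
    · exact ⟨hc j i h.symm, hc i j h⟩

end Bridges

variable {ι : Type u} {T : SimpleGraph ι} {V : ι → Type v} {G : ∀ i, SimpleGraph (V i)}
  {dT : ι → ι → ℕ} (hT : IsTreeMetric T dT) (C : TreeChain T G)
  [Fintype ι] [∀ i, Fintype (V i)] (d : ∀ i, V i → V i → ℕ)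

/-- The contribution of block `l` to the sum of the distances in the chain. -/
noncomputable def blockSum (l : ι) : ℕ := ∑ x, ∑ y, d l (C.proj hT l x) (C.proj hT l y)

/-- The `dT` part does not depend on the chain, so only the block sums need comparing. -/
theorem sum_chainDist : ∑ x, ∑ y, C.chainDist hT d x y
    = ∑ x : Σ i, V i, ∑ y : Σ i, V i, dT x.1 y.1 + ∑ l, C.blockSum hT d l := by
  unfold chainDist blockSum
  simp only [Finset.sum_add_distrib]
  congr 1
  rw [Finset.sum_comm]
  calc _ = ∑ y : Σ i, V i, ∑ l, ∑ x, d l (C.proj hT l x) (C.proj hT l y) :=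
        Finset.sum_congr rfl fun y _ => Finset.sum_comm
    _ = ∑ l, ∑ y, ∑ x, d l (C.proj hT l x) (C.proj hT l y) := Finset.sum_comm
    _ = _ := Finset.sum_congr rfl fun l _ => Finset.sum_comm

open Classical in
theorem sum_eq_sum_block_add (l : ι) (f : (Σ i, V i) → ℕ) :
    ∑ x, f x = ∑ a, f ⟨l, a⟩ + ∑ x with x.1 ≠ l, f x := by
  rw [← Finset.sum_filter_add_sum_filter_not Finset.univ (fun x : Σ i, V i => x.1 = l)]
  congr 1
  symm
  refine Finset.sum_bij (fun a _ => (⟨l, a⟩ : Σ i, V i)) ?_ ?_ ?_ ?_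
  · simp
  · intro a _ b _ hab
    simpa using hab
  · rintro ⟨i, a⟩ hi
    simp only [Finset.mem_filter, Finset.mem_univ, true_and] at hi
    subst hi
    exact ⟨a, Finset.mem_univ _, rfl⟩
  · intros; rfl

open Classical in
theorem blockSum_eq (hd : ∀ i, IsTreeMetric (G i) (d i)) (l : ι) :
    C.blockSum hT d l = ∑ a, ∑ b, d l a b
      + 2 * ∑ x : Σ i, V i with x.1 ≠ l, ∑ b, d l (C.proj hT l x) b
      + ∑ x : Σ i, V i with x.1 ≠ l, ∑ y : Σ i, V i with y.1 ≠ l,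
          d l (C.proj hT l x) (C.proj hT l y) := by
  unfold blockSum
  rw [sum_eq_sum_block_add l]
  simp only [sum_eq_sum_block_add l (fun y => d l _ (C.proj hT l y)), proj_mk_self,
    Finset.sum_add_distrib]
  have h1 : ∑ a, ∑ y : Σ i, V i with y.1 ≠ l, d l a (C.proj hT l y)
      = ∑ x : Σ i, V i with x.1 ≠ l, ∑ b, d l (C.proj hT l x) b := by
    rw [Finset.sum_comm]
    exact Finset.sum_congr rfl fun x _ => Finset.sum_congr rfl fun b _ => (hd l).comm _ _
  rw [h1]
  ring

open Classical in
/-- The least possible value of `blockSum`, when `μ` is the least sum of distances in block `l`. -/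
noncomputable def blockBound (d : ∀ i, V i → V i → ℕ) (μ : ι → ℕ) (l : ι) : ℕ :=
  ∑ a, ∑ b, d l a b + 2 * ∑ x : Σ i, V i with x.1 ≠ l, μ l

variable {d} {μ : ι → ℕ}

theorem blockBound_le (hd : ∀ i, IsTreeMetric (G i) (d i)) (hμ : ∀ i a, μ i ≤ ∑ b, d i a b)
    (l : ι) : blockBound d μ l ≤ C.blockSum hT d l := by
  classical
  rw [C.blockSum_eq hT d hd, blockBound]
  have := Finset.sum_le_sum (s := Finset.univ.filter fun x : Σ i, V i => x.1 ≠ l)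
    fun x _ => hμ l (C.proj hT l x)
  omega

/-- Equality forces every mixed term to equal `μ l` and every outside pair to contribute `0`. A
point of the nonempty block `j` next to `l` projects to `C.vertex l j h`, so these conditions reach
every attachment vertex. -/
theorem blockSum_eq_blockBound_iff [∀ i, Nonempty (V i)] (hd : ∀ i, IsTreeMetric (G i) (d i))
    (hμ : ∀ i a, μ i ≤ ∑ b, d i a b) (l : ι) :
    C.blockSum hT d l = blockBound d μ l ↔
      (∀ j h, ∑ b, d l (C.vertex l j h) b = μ l) ∧
        ∀ j j' h h', C.vertex l j h = C.vertex l j' h' := by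
  classical
  have hle := Finset.sum_le_sum (s := Finset.univ.filter fun x : Σ i, V i => x.1 ≠ l)
    fun x _ => hμ l (C.proj hT l x)
  have hiff := Finset.sum_eq_sum_iff_of_le (s := Finset.univ.filter fun x : Σ i, V i => x.1 ≠ l)
    fun x _ => hμ l (C.proj hT l x)
  rw [C.blockSum_eq hT d hd, blockBound]
  constructor
  · intro he
    have h1 := hiff.1 (by omega)
    have h2 : ∑ x : Σ i, V i with x.1 ≠ l, ∑ y : Σ i, V i with y.1 ≠ l,
        d l (C.proj hT l x) (C.proj hT l y) = 0 := by omega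
    simp only [Finset.sum_eq_zero_iff, Finset.mem_filter, Finset.mem_univ, true_and] at h1 h2
    constructor
    · intro j h
      have h3 := h1 ⟨j, Classical.arbitrary _⟩ h.ne'
      rw [proj_mk_of_adj hT C h] at h3
      exact h3.symm
    · intro j j' h h'
      have h3 := h2 ⟨j, Classical.arbitrary _⟩ h.ne' ⟨j', Classical.arbitrary _⟩ h'.ne'
      rw [proj_mk_of_adj hT C h, proj_mk_of_adj hT C h'] at h3
      exact (hd l).eq_of_dist_eq_zero h3
  · rintro ⟨h1, h2⟩
    have h3 := hiff.2 (by
      rintro ⟨i, a⟩ hi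
      have hi : i ≠ l := by simpa using hi
      rw [proj_mk_of_ne hT C hi.symm, h1])
    rw [← h3, Finset.sum_eq_zero (s := Finset.univ.filter fun x : Σ i, V i => x.1 ≠ l)
      (f := fun x => ∑ y : Σ i, V i with y.1 ≠ l, d l (C.proj hT l x) (C.proj hT l y)), add_zero]
    rintro ⟨i, a⟩ hi
    refine Finset.sum_eq_zero ?_
    rintro ⟨j, b⟩ hj
    have hi : i ≠ l := by simpa using hi
    have hj : j ≠ l := by simpa using hj
    rw [proj_mk_of_ne hT C hi.symm, proj_mk_of_ne hT C hj.symm,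
      h2 _ _ (hT.adj_next hi.symm) (hT.adj_next hj.symm), (hd l).self]

theorem forall_sum_chainDist_le_iff [∀ i, Nonempty (V i)] (hd : ∀ i, IsTreeMetric (G i) (d i)) :
    (∀ C' : TreeChain T G, ∑ x, ∑ y, C.chainDist hT d x y ≤ ∑ x, ∑ y, C'.chainDist hT d x y) ↔
      (∀ i j h, IsCentroid (G i) (C.vertex i j h)) ∧
        ∀ i j j' h h', C.vertex i j h = C.vertex i j' h' := by
  have hm : ∀ i, ∃ m : V i, ∀ a, ∑ b, d i m b ≤ ∑ b, d i a b := fun i =>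
    Finite.exists_min fun a => ∑ b, d i a b
  choose m hm using hm
  have hcent : ∀ i a, IsCentroid (G i) a ↔ ∑ b, d i a b = ∑ b, d i (m i) b := fun i a => by
    rw [(hd i).isCentroid_iff]
    exact ⟨fun h => le_antisymm (h _) (hm i a), fun h u => h ▸ hm i u⟩
  simp only [sum_chainDist, add_le_add_iff_left, hcent]
  have hle := fun C' : TreeChain T G =>
    Finset.sum_le_sum fun l (_ : l ∈ Finset.univ) => C'.blockBound_le hT hd hm l
  have hiff := fun C' : TreeChain T G =>
    Finset.sum_eq_sum_iff_of_le fun l (_ : l ∈ Finset.univ) => C'.blockBound_le hT hd hm l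
  have key : (∀ C' : TreeChain T G, ∑ l, C.blockSum hT d l ≤ ∑ l, C'.blockSum hT d l) ↔
      ∀ l, C.blockSum hT d l = blockBound d (fun i => ∑ b, d i (m i) b) l := by
    constructor
    · intro hmin l
      -- The chain with all bridges at the minimisers `m i` attains every bound, so a minimal chain
      -- has the sum of the bounds as its total, and equality holds block by block.
      have h0 := (hiff ⟨fun i _ _ => m i⟩).2 fun l _ =>
        ((blockSum_eq_blockBound_iff hT _ hd hm l).2 ⟨fun _ _ => rfl, fun _ _ _ _ => rfl⟩).symm
      have h1 := hmin ⟨fun i _ _ => m i⟩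
      rw [← h0] at h1
      exact ((hiff C).1 (le_antisymm (hle C) h1) l (Finset.mem_univ l)).symm
    · intro h C'
      simp only [h]
      exact hle C'
  rw [key]
  simp only [C.blockSum_eq_blockBound_iff hT hd hm, forall_and]

end TreeChain

end KemenyChain

theorem mainTheorem10 {ι : Type*} [Fintype ι] (hk : 2 ≤ Fintype.card ι)
    (T : SimpleGraph ι) (hT : T.IsTree)
    {V : ι → Type*} [∀ i, Fintype (V i)]
    (G : ∀ i, SimpleGraph (V i)) (hG : ∀ i, (G i).IsTree)
    (C : KemenyChain.TreeChain T G) :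
    (∀ C' : KemenyChain.TreeChain T G,
        KemenyChain.kemeny C.graph ≤ KemenyChain.kemeny C'.graph) ↔
      (∀ x y : Σ i, V i, s(x, y) ∈ C.bridges →
        KemenyChain.IsCentroid (G x.1) x.2 ∧ KemenyChain.IsCentroid (G y.1) y.2) ∧
      ∀ i, ∃ z, C.bridgeVertices i = {z} := by
  classical
  have hne : ∀ i, Nonempty (V i) := fun i => (hG i).connected.nonempty
  have hTm := hT.isTreeMetric_dist
  have hd := fun i => (hG i).isTreeMetric_dist
  have hcard : 2 ≤ Fintype.card (Σ i, V i) := by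
    rw [Fintype.card_sigma]
    refine hk.trans ?_
    rw [← Finset.card_univ, Finset.card_eq_sum_ones]
    exact Finset.sum_le_sum fun i _ => Fintype.card_pos
  have hkem := fun C' : KemenyChain.TreeChain T G => KemenyChain.kemeny_le_kemeny_iff
    (C.isTreeMetric_chainDist hTm hd) (C'.isTreeMetric_chainDist hTm hd) hcard
  rw [forall_congr' hkem, C.forall_sum_chainDist_le_iff hTm hd, C.forall_bridges_isCentroid_iff]
  refine and_congr_right fun _ => forall_congr' fun i => ?_
  constructor
  · intro h
    -- Coincidence of attachment vertices gives a singleton only if some bridge meets block `i`; `2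
    -- ≤ Fintype.card ι` provides one.
    obtain ⟨j, hj⟩ : ∃ j, T.Adj i j := by
      have : Nontrivial ι := Fintype.one_lt_card_iff_nontrivial.1 hk
      obtain ⟨l, hl⟩ := exists_ne i
      exact ⟨_, hTm.adj_next hl.symm⟩
    refine ⟨C.vertex i j hj, Set.ext fun a => ?_⟩
    rw [C.mem_bridgeVertices_iff, Set.mem_singleton_iff]
    exact ⟨fun ⟨j', h', e⟩ => e.trans (h _ _ _ _), fun e => ⟨j, hj, e⟩⟩
  · rintro ⟨z, hz⟩ j j' h h'
    have h1 : ∀ j h, C.vertex i j h = z := fun j h => by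
      have : C.vertex i j h ∈ C.bridgeVertices i := C.mem_bridgeVertices_iff.2 ⟨j, h, rfl⟩
      rwa [hz] at this
    rw [h1, h1]
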